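/- Let $\mathbb S\subset\mathbb R$ be a finite set and let $\boldsymbol G=(G(x,y))_{x,y\in\mathbb S}$ be a transition rate matrix, i.e. $G(x,y)\ge 0$ for $x\ne y$ and $G(x,x)=-\sum_{y\ne x}G(x,y)$. Let $Y=(Y_t)_{t\ge 0}$ be a continuous-time Markov chain with c\`adl\`ag paths, state space $\mathbb S$, rate matrix $\boldsymbol G$ (transition function $e^{t\boldsymbol G}$), and let $a>0$. (The chain may, but need not, be absorbed at $\min\mathbb S$ and $\max\mathbb S$.) For $x,y\in\mathbb S$, write $\mathbb E[\,\cdot\mid Y_0=x,\overline Y_0=y]$ for the expectation when the chain starts at $x$ and its running maximum is initialised at $y$, that is, $\overline Y_t=\max\{y,\sup_{0\le u\le t}Y_u\}$ for $t\ge 0$ (so the initial running maximum is $y$ when $x\le y$, and is $x$ when $x>y$). Write $\overline Y_{s,t}=\sup_{s\le u\le t}Y_u$. The drawdown times with recovery are $\tau_{a,0}=0$ and $$\tau_{a,n}=\inf\{t>\tau_{a,n-1}:\ \overline Y_t-Y_t\ge a,\ \overline Y_{\tau_{a,n-1},t}\ge\overline Y_{\tau_{a,n-1}}\},\qquad n\ge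 1,$$ with $\inf\emptyset=\infty$ and $\tau_{a,n}=\infty$ if $\tau_{a,n-1}=\infty$. For $A\subseteq\mathbb R$ let $T_A=\inf\{t>0: Y_t\notin A\}$ and, for $f:\mathbb S\to\mathbb C$, $$P_A(q,x;f)=\mathbb E\big[e^{-qT_A}\mathbf 1_{\{T_A<\infty\}}f(Y_{T_A})\,\big|\,Y_0=x\big].$$ Let $q\in\mathbb C$ with $\Re(q)>0$ (and $e^{-q\cdot\infty}:=0$). Then, for all $x,y\in\mathbb S$, the random variables $e^{-q\tau_{a,k}}$ ($k\ge1$) are integrable, the series $$J(q,x,y)=\sum_{k=1}^\infty\mathbb E\big[e^{-q\tau_{a,k}}\,\big|\,Y_0=x,\overline Y_0=y\big]$$ converges absolutely, and $$J(q,x,y)=\sum_{z\in\mathbb S,\,z\ge y}P_{(-\infty,y)}(q,x;\mathbf 1_{\{\cdot=z\}})\,J(q,z,z),$$ $$J(q,y,y)=\sum_{z\in\mathbb S,\,z\le y-a}P_{(y-a,y]}(q,y;\mathbf 1_{\{\cdot=z\}})\,\big(1+J(q,z,y)\big)+\sum_{z\in\mathbb S,\,z>y}P_{(y-a,y]}(q,y;\mathbf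 1_{\{\cdot=z\}})\,J(q,z,z).$$ -/

import Mathlib

open MeasureTheory Set Filter Topology
open scoped NNReal ENNReal

noncomputable section

/-- Transition rate matrix on the finite set `S` of reals: nonnegative off-diagonal entries and
zero row sums. -/
structure IsRateMatrix {S : Finset ℝ} (G : Matrix S S ℝ) : Prop where
  nonneg_off_diag : ∀ x y : S, x ≠ y → 0 ≤ G x y
  diag : ∀ x : S, G x x = -∑ y ∈ Finset.univ.erase x, G x y

/-- `Y`, together with the laws `P x` (the chain started from `x`), is a time-homogeneous
continuous-time Markov chain with state space `S`, transition rate matrix `G` and càdlàg paths: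
given the past up to time `s`, the state at time `s + t` is distributed according to the row of
`exp (t G)` indexed by the state at time `s`. -/
structure IsCTMC {Ω : Type*} [MeasurableSpace Ω] {S : Finset ℝ} (G : Matrix S S ℝ)
    (P : S → Measure Ω) (Y : ℝ≥0 → Ω → S) : Prop where
  prob : ∀ x : S, IsProbabilityMeasure (P x)
  measurable : ∀ t : ℝ≥0, Measurable (Y t)
  right_continuous : ∀ (ω : Ω) (t : ℝ≥0), ContinuousWithinAt (fun s => Y s ω) (Ici t) t
  left_limits : ∀ (ω : Ω) (t : ℝ≥0), ∃ l : S, Tendsto (fun s => Y s ω) (𝓝[<] t) (𝓝 l)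
  start : ∀ x : S, ∀ᵐ ω ∂(P x), Y 0 ω = x
  markov : ∀ (x : S) (s t : ℝ≥0) (A : Set Ω),
    MeasurableSet[⨆ u ∈ Iic s, MeasurableSpace.comap (Y u) inferInstance] A →
    ∀ y z : S,
      (P x).real (A ∩ {ω | Y s ω = y} ∩ {ω | Y (s + t) ω = z}) =
        (P x).real (A ∩ {ω | Y s ω = y}) * NormedSpace.exp ((t : ℝ) • G) y z

/-- First passage time `T_A = inf {t > 0 : w t ∉ A}` of a path `w` (`∞` if there is none). -/
def firstPassage (A : Set ℝ) (w : ℝ≥0 → ℝ) : ℝ≥0∞ :=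
  sInf {T : ℝ≥0∞ | ∃ t : ℝ≥0, 0 < t ∧ w t ∉ A ∧ T = t}

/-- `P_A(k, x; f) = E_x[exp (-∫_0^{T_A} k(Y_s) ds) 1_{T_A < ∞} f(Y_{T_A})]`. -/
def passageTransform {Ω : Type*} [MeasurableSpace Ω] {S : Finset ℝ}
    (P : S → Measure Ω) (Y : ℝ≥0 → Ω → S) (A : Set ℝ) (k : S → ℂ) (x : S) (f : S → ℂ) : ℂ :=
  ∫ ω, (let T := firstPassage A (fun t => (Y t ω : ℝ))
    if T = ∞ then 0
    else Complex.exp (-∫ s in (0 : ℝ)..T.toReal, k (Y s.toNNReal ω)) * f (Y T.toNNReal ω)) ∂(P x)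

/-- `sup_{s ≤ u ≤ t} w u`. -/
def supBetween (w : ℝ≥0 → ℝ) (s t : ℝ≥0) : ℝ := sSup (w '' Icc s t)

/-- Running maximum at time `t` of the path `w`, when the running maximum is initialised at `y`
at time `0`. -/
def runningMax (y : ℝ) (w : ℝ≥0 → ℝ) (t : ℝ≥0) : ℝ := max y (supBetween w 0 t)

/-- The `n`-th drawdown time with recovery of the path `w`, for the threshold `a` and the initial
running maximum `y`. After the `(n-1)`-st such time `s`, the path first has to climb back to (or
above) the running maximum attained at `s`; the `n`-th time is the first time thereafter at which
the drawdown is at least `a`. The value is `∞` if there is no such time. -/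
def drawdownTime (a y : ℝ) (w : ℝ≥0 → ℝ) : ℕ → ℝ≥0∞
  | 0 => 0
  | n + 1 => sInf {T : ℝ≥0∞ | ∃ s t : ℝ≥0, drawdownTime a y w n = s ∧ s < t ∧
      a ≤ runningMax y w t - w t ∧ runningMax y w s ≤ supBetween w s t ∧ T = t}

/-- `e^{-qT}`, with the value `0` at `T = ∞`. -/
def discount (q : ℂ) (T : ℝ≥0∞) : ℂ := if T = ∞ then 0 else Complex.exp (-q * (T.toReal : ℂ))

/-- The discount factor `e^{-q τ_{a,n}}` along the chain, the running maximum being started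
at `y`. -/
def drawdownDiscount {Ω : Type*} {S : Finset ℝ} (Y : ℝ≥0 → Ω → S) (a : ℝ) (q : ℂ) (y : S)
    (n : ℕ) (ω : Ω) : ℂ :=
  discount q (drawdownTime a y (fun t => (Y t ω : ℝ)) n)

/-- `J(q, x, y) = ∑_{n ≥ 1} E[e^{-q τ_{a,n}} | Y_0 = x, running maximum at time 0 = y]`. -/
def drawdownSum {Ω : Type*} [MeasurableSpace Ω] {S : Finset ℝ}
    (P : S → Measure Ω) (Y : ℝ≥0 → Ω → S) (a : ℝ) (q : ℂ) (x y : S) : ℂ :=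
  ∑' n : ℕ, ∫ ω, drawdownDiscount Y a q y (n + 1) ω ∂(P x)

/-- The indicator function `1_{· = z}`. -/
def pointIndicator {S : Finset ℝ} (z : S) : S → ℂ := fun u => if u = z then 1 else 0

end

/-! Both identities are renewal equations at a first exit time `T`, and they hold term by term in
the series.

Since the state space is discrete, the paths are locally constant to the right. Recovery before `t`
therefore means that the path visits its running maximum at some `u < t` not earlier than the
previous drawdown time. In this form the drawdown times behave well under time shifts. While the
path stays in `Iio y` it is below its maximum, so no time is counted; at the exit the running
maximum is the current state and everything starts afresh. From `y`, nothing is counted inside `Ioc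
(y - a) y`. A downward exit is the first drawdown time: the maximum stays `y` and the index drops by
one. An upward exit is a new maximum and leaves the index unchanged.

The strong Markov property at `T` (`map_optionalTime_eq_prod`) turns these pathwise identities into
a recursion for the expected discount factors, with the passage transforms as coefficients
(`integral_drawdownDiscount_eq_sum`).

For convergence, the exit from `Ioc (y - a) y` takes a positive time, so the coefficients have
absolute sum below `1`, uniformly over the finite state space. This gives geometric decay
(`exists_norm_integral_drawdownDiscount_le_pow`), and the recursion can be summed over the index. -/

/-- A path with finitely many values that is locally constant to the right. -/
structure IsStepPath (w : ℝ≥0 → ℝ) : Prop where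
  finite_range : (range w).Finite
  eventually_eq : ∀ t, ∀ᶠ s in 𝓝[≥] t, w s = w t

/-! ### Step paths and their running maximum -/

namespace IsStepPath

variable {w : ℝ≥0 → ℝ}

theorem exists_Ico (hw : IsStepPath w) {t c : ℝ≥0} (htc : t < c) :
    ∃ r, t < r ∧ r ≤ c ∧ ∀ s ∈ Ico t r, w s = w t := by
  obtain ⟨r, hr, hs⟩ := (mem_nhdsGE_iff_exists_Ico_subset' htc).1 (hw.eventually_eq t)
  exact ⟨min r c, lt_min hr htc, min_le_right _ _,
    fun s h => hs ⟨h.1, h.2.trans_le (min_le_left _ _)⟩⟩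

theorem shift (hw : IsStepPath w) (T : ℝ≥0) : IsStepPath fun t => w (T + t) := by
  refine ⟨hw.finite_range.subset (range_comp_subset_range (T + ·) w), fun t => ?_⟩
  have h : Tendsto (fun s => T + s) (𝓝[≥] t) (𝓝[≥] (T + t)) := by
    refine tendsto_nhdsWithin_iff.2 ⟨?_, ?_⟩
    · exact ((continuous_const.add continuous_id).tendsto t).mono_left nhdsWithin_le_nhds
    · filter_upwards [self_mem_nhdsWithin] with s hs
      exact add_le_add_right hs T
  exact h.eventually (hw.eventually_eq (T + t))

theorem le_supBetween (hw : IsStepPath w) {s t u : ℝ≥0} (hs : s ≤ u) (ht : u ≤ t) :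
    w u ≤ supBetween w s t :=
  le_csSup (hw.finite_range.subset (image_subset_range _ _)).bddAbove ⟨u, ⟨hs, ht⟩, rfl⟩

theorem exists_eq_supBetween (hw : IsStepPath w) {s t : ℝ≥0} (h : s ≤ t) :
    ∃ u ∈ Icc s t, w u = supBetween w s t :=
  ((nonempty_Icc.2 h).image w).csSup_mem (hw.finite_range.subset (image_subset_range _ _))

theorem runningMax_le_iff (hw : IsStepPath w) {y c : ℝ} {t : ℝ≥0} :
    runningMax y w t ≤ c ↔ y ≤ c ∧ ∀ u ≤ t, w u ≤ c := by
  refine max_le_iff.trans (and_congr_right fun _ => ⟨fun h u hu => ?_, fun h => ?_⟩)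
  · exact (hw.le_supBetween zero_le hu).trans h
  · obtain ⟨u, hu, e⟩ := hw.exists_eq_supBetween (zero_le (a := t))
    exact e ▸ h u hu.2

theorem le_runningMax (hw : IsStepPath w) {y : ℝ} {u t : ℝ≥0} (h : u ≤ t) :
    w u ≤ runningMax y w t :=
  (hw.runningMax_le_iff.1 le_rfl).2 u h

theorem runningMax_mono (hw : IsStepPath w) {y : ℝ} {u t : ℝ≥0} (h : u ≤ t) :
    runningMax y w u ≤ runningMax y w t :=
  hw.runningMax_le_iff.2 ⟨le_max_left _ _, fun _ hv => hw.le_runningMax (hv.trans h)⟩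

theorem runningMax_eq_of_const (hw : IsStepPath w) {y : ℝ} {t s : ℝ≥0} (hts : t ≤ s)
    (h : ∀ u ∈ Icc t s, w u = w t) : runningMax y w s = runningMax y w t := by
  refine le_antisymm (hw.runningMax_le_iff.2 ⟨le_max_left _ _, fun u hu => ?_⟩)
    (hw.runningMax_mono hts)
  rcases le_total u t with hut | hut
  · exact hw.le_runningMax hut
  · exact (h u ⟨hut, hu⟩).trans_le (hw.le_runningMax le_rfl)

/-- Only `max m (w T)` matters for the restarted maximum, so `m` may be the old maximum or, at a new
maximum, the current state. -/
theorem runningMax_shift (hw : IsStepPath w) {y m : ℝ} {T : ℝ≥0}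
    (hm : max m (w T) = runningMax y w T) (t : ℝ≥0) :
    runningMax m (fun s => w (T + s)) t = runningMax y w (T + t) := by
  apply le_antisymm
  · refine (hw.shift T).runningMax_le_iff.2 ⟨?_, fun u hu => ?_⟩
    · exact (le_max_left _ _).trans (hm.trans_le (hw.runningMax_mono le_self_add))
    · exact hw.le_runningMax (add_le_add_right hu T)
  · have h : runningMax y w T ≤ runningMax m (fun s => w (T + s)) t := by
      rw [← hm]
      refine max_le (le_max_left _ _) ?_
      simpa using (hw.shift T).le_runningMax (y := m) (zero_le (a := t))
    refine hw.runningMax_le_iff.2 ⟨(le_max_left _ _).trans h, fun u hu => ?_⟩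
    rcases le_total u T with hut | hut
    · exact (hw.le_runningMax hut).trans h
    · obtain ⟨v, rfl⟩ := exists_add_of_le hut
      exact (hw.shift T).le_runningMax (le_of_add_le_add_left hu)

end IsStepPath

/-! ### Drawdown times and time shifts -/

/-- The times with drawdown at least `a` before which, but not before `d`, the path has been at
its running maximum. -/
def drawdownSet (a y : ℝ) (w : ℝ≥0 → ℝ) (d : ℝ≥0∞) : Set ℝ≥0 :=
  {t | a ≤ runningMax y w t - w t ∧ ∃ u < t, d ≤ u ∧ runningMax y w u ≤ w u}

/-- A point where the supremum since the last drawdown time is attained is a visit to the running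
maximum as soon as recovery has happened. The visit is strictly before `t` because the drawdown
vanishes there and `0 < a`. -/
theorem drawdownTime_succ {a y : ℝ} {w : ℝ≥0 → ℝ} (ha : 0 < a) (hw : IsStepPath w) (n : ℕ) :
    drawdownTime a y w (n + 1) =
      sInf ((fun t : ℝ≥0 => (t : ℝ≥0∞)) '' drawdownSet a y w (drawdownTime a y w n)) := by
  rw [drawdownTime]
  congr 1
  ext T
  constructor
  · rintro ⟨s, t, hs, hst, hd, hr, rfl⟩
    refine ⟨t, ⟨hd, ?_⟩, rfl⟩
    obtain ⟨u, hu, e⟩ := hw.exists_eq_supBetween hst.le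
    have hM : runningMax y w u ≤ w u := by
      refine hw.runningMax_le_iff.2 ⟨(le_max_left _ _).trans (hr.trans e.ge), fun v hv => ?_⟩
      rcases le_total v s with hvs | hvs
      · exact (hw.le_runningMax hvs).trans (hr.trans e.ge)
      · exact (hw.le_supBetween hvs (hv.trans hu.2)).trans e.ge
    refine ⟨u, lt_of_le_of_ne hu.2 ?_, ?_, hM⟩
    · rintro rfl
      linarith
    · rw [hs]
      exact_mod_cast hu.1
  · rintro ⟨t, ⟨hd, u, hut, hu, hM⟩, rfl⟩
    obtain ⟨s, hs⟩ : ∃ s : ℝ≥0, (s : ℝ≥0∞) = drawdownTime a y w n :=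
      ⟨_, ENNReal.coe_toNNReal (hu.trans_lt ENNReal.coe_lt_top).ne⟩
    rw [← hs, ENNReal.coe_le_coe] at hu
    exact ⟨s, t, hs.symm, hu.trans_lt hut, hd,
      (hw.runningMax_mono hu).trans (hM.trans (hw.le_supBetween hu hut.le)), rfl⟩

theorem sInf_coe_image_add (T : ℝ≥0) (B : Set ℝ≥0) :
    sInf ((fun t : ℝ≥0 => (t : ℝ≥0∞)) '' ((T + ·) '' B)) =
      T + sInf ((fun t : ℝ≥0 => (t : ℝ≥0∞)) '' B) := by
  rw [image_image, ENNReal.add_sInf, sInf_image, iInf_image]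
  simp

section Shift

variable {a y m : ℝ} {w : ℝ≥0 → ℝ} {T : ℝ≥0}

/-- The recovery conditions need to agree only at times `t` that already have drawdown at least `a`;
the two drawdown sets are then translates by `T`. -/
theorem drawdownTime_succ_shift (ha : 0 < a) (hw : IsStepPath w)
    (hm : max m (w T) = runningMax y w T) {k j : ℕ}
    (h : ∀ t, a ≤ runningMax y w t - w t →
      ((∃ u < t, drawdownTime a y w k ≤ u ∧ runningMax y w u ≤ w u) ↔
        ∃ v, T + v < t ∧ drawdownTime a m (fun s => w (T + s)) j ≤ v ∧
          runningMax y w (T + v) ≤ w (T + v))) :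
    drawdownTime a y w (k + 1) = T + drawdownTime a m (fun s => w (T + s)) (j + 1) := by
  rw [drawdownTime_succ ha hw, drawdownTime_succ ha (hw.shift T), ← sInf_coe_image_add]
  congr 2
  ext t
  simp only [drawdownSet, mem_ofPred_eq, mem_image, hw.runningMax_shift hm]
  constructor
  · rintro ⟨hd, hu⟩
    obtain ⟨v, hv, hv'⟩ := (h t hd).1 hu
    obtain ⟨s, rfl⟩ := exists_add_of_le (le_self_add.trans hv.le)
    exact ⟨s, ⟨hd, v, lt_of_add_lt_add_left hv, hv'⟩, rfl⟩
  · rintro ⟨s, ⟨hd, v, hv, hv'⟩, rfl⟩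
    exact ⟨hd, (h _ hd).2 ⟨v, add_lt_add_right hv T, hv'⟩⟩

theorem drawdownTime_add_shift (ha : 0 < a) (hw : IsStepPath w)
    (hm : max m (w T) = runningMax y w T) {k j : ℕ}
    (h : drawdownTime a y w k = T + drawdownTime a m (fun s => w (T + s)) j) (n : ℕ) :
    drawdownTime a y w (k + n) = T + drawdownTime a m (fun s => w (T + s)) (j + n) := by
  induction n with
  | zero => exact h
  | succ n ih =>
    refine drawdownTime_succ_shift (k := k + n) (j := j + n) ha hw hm fun t _ => ⟨?_, ?_⟩
    · rintro ⟨u, hut, hu, hM⟩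
      rw [ih] at hu
      obtain ⟨v, rfl⟩ := exists_add_of_le (ENNReal.coe_le_coe.1 (le_self_add.trans hu))
      rw [ENNReal.coe_add] at hu
      exact ⟨v, hut, (ENNReal.add_le_add_iff_left ENNReal.coe_ne_top).1 hu, hM⟩
    · rintro ⟨v, hvt, hv, hM⟩
      refine ⟨T + v, hvt, ?_, hM⟩
      rw [ih, ENNReal.coe_add]
      gcongr

end Shift

/-! ### First passage times of step paths -/

section FirstPassage

variable {A : Set ℝ} {w : ℝ≥0 → ℝ}

theorem firstPassage_le {t : ℝ≥0} (h0 : 0 < t) (hA : w t ∉ A) : firstPassage A w ≤ t :=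
  sInf_le ⟨t, h0, hA, rfl⟩

theorem mem_of_lt_firstPassage (hw : IsStepPath w) {t : ℝ≥0} (h : (t : ℝ≥0∞) < firstPassage A w) :
    w t ∈ A := by
  have pos : ∀ s : ℝ≥0, 0 < s → (s : ℝ≥0∞) < firstPassage A w → w s ∈ A := by
    intro s hs hsT
    by_contra hA
    exact (firstPassage_le hs hA).not_gt hsT
  -- The infimum runs over positive times only, so `t = 0` is reached from the right by local
  -- constancy.
  obtain ⟨c, htc, hc⟩ := ENNReal.lt_iff_exists_nnreal_btwn.1 h
  obtain ⟨r, htr, hrc, hr⟩ := hw.exists_Ico (ENNReal.coe_lt_coe.1 htc)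
  obtain ⟨s, hts, hsr⟩ := exists_between htr
  rw [← hr s ⟨hts.le, hsr⟩]
  exact pos s (zero_le.trans_lt hts) ((ENNReal.coe_lt_coe.2 (hsr.trans_le hrc)).trans hc)

theorem exists_of_firstPassage_lt {c : ℝ≥0∞} (h : firstPassage A w < c) :
    ∃ t : ℝ≥0, 0 < t ∧ w t ∉ A ∧ (t : ℝ≥0∞) < c := by
  obtain ⟨_, ⟨t, h0, hA, rfl⟩, hc⟩ := sInf_lt_iff.1 h
  exact ⟨t, h0, hA, hc⟩

theorem notMem_of_firstPassage_eq (hw : IsStepPath w) {T : ℝ≥0} (h : firstPassage A w = T) :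
    w T ∉ A := by
  obtain ⟨r, htr, -, hr⟩ := hw.exists_Ico (lt_add_one T)
  obtain ⟨t, h0, hA, ht⟩ := exists_of_firstPassage_lt (h.trans_lt (ENNReal.coe_lt_coe.2 htr))
  have hTt : (T : ℝ≥0∞) ≤ t := h ▸ firstPassage_le h0 hA
  rwa [← hr t ⟨ENNReal.coe_le_coe.1 hTt, ENNReal.coe_lt_coe.1 ht⟩]

theorem firstPassage_pos (hw : IsStepPath w) (h : w 0 ∈ A) : 0 < firstPassage A w := by
  by_contra h0
  exact notMem_of_firstPassage_eq (T := 0) hw (by simpa using h0) h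

/-- An exit persists for a moment, so with a strict bound countably many times suffice to detect it.
-/
theorem firstPassage_lt_iff (hw : IsStepPath w) {c : ℝ≥0∞} :
    firstPassage A w < c ↔
      ∃ i, 0 < TopologicalSpace.denseSeq ℝ≥0 i ∧
        (TopologicalSpace.denseSeq ℝ≥0 i : ℝ≥0∞) < c ∧ w (TopologicalSpace.denseSeq ℝ≥0 i) ∉ A := by
  constructor
  · intro h
    obtain ⟨t, h0, hA, htc⟩ := exists_of_firstPassage_lt h
    obtain ⟨c', htc', hc'⟩ := ENNReal.lt_iff_exists_nnreal_btwn.1 htc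
    obtain ⟨r, htr, hrc, hr⟩ := hw.exists_Ico (ENNReal.coe_lt_coe.1 htc')
    obtain ⟨_, ⟨i, rfl⟩, hi⟩ := (TopologicalSpace.denseRange_denseSeq ℝ≥0).exists_between htr
    exact ⟨i, h0.trans hi.1, (ENNReal.coe_lt_coe.2 (hi.2.trans_le hrc)).trans hc',
      (hr _ ⟨hi.1.le, hi.2⟩).symm ▸ hA⟩
  · rintro ⟨i, h0, hc, hA⟩
    exact (firstPassage_le h0 hA).trans_lt hc

end FirstPassage

/-! ### Pathwise renewal at the first exit -/

section Decomposition

variable {a y : ℝ} {w : ℝ≥0 → ℝ}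

theorem drawdownTime_succ_eq_top_of_forall {n : ℕ} (ha : 0 < a) (hw : IsStepPath w)
    (h : ∀ t u : ℝ≥0, u < t → a ≤ runningMax y w t - w t → ¬ runningMax y w u ≤ w u) :
    drawdownTime a y w (n + 1) = ∞ := by
  rw [drawdownTime_succ ha hw, sInf_eq_top]
  rintro _ ⟨t, ⟨hd, u, hut, -, hM⟩, rfl⟩
  exact (h t u hut hd hM).elim

theorem drawdownTime_eq_top_of_firstPassage_Iio (ha : 0 < a) (hw : IsStepPath w)
    (h : firstPassage (Iio y) w = ∞) (n : ℕ) : drawdownTime a y w (n + 1) = ∞ := by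
  refine drawdownTime_succ_eq_top_of_forall ha hw fun t u _ _ hM => ?_
  have : w u < y := mem_of_lt_firstPassage hw (h ▸ ENNReal.coe_lt_top)
  exact ((le_max_left _ _).trans hM).not_gt this

theorem drawdownTime_of_firstPassage_Iio (ha : 0 < a) (hw : IsStepPath w) {T : ℝ≥0}
    (h : firstPassage (Iio y) w = T) (n : ℕ) :
    drawdownTime a y w (n + 1) = T + drawdownTime a (w T) (fun s => w (T + s)) (n + 1) := by
  have hT : y ≤ w T := not_lt.1 (notMem_of_firstPassage_eq hw h)
  have hlt : ∀ u < T, w u < y := fun u hu =>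
    mem_of_lt_firstPassage hw (h ▸ ENNReal.coe_lt_coe.2 hu)
  have hm : max (w T) (w T) = runningMax y w T := by
    rw [max_self]
    refine le_antisymm (hw.le_runningMax le_rfl) (hw.runningMax_le_iff.2 ⟨hT, fun u hu => ?_⟩)
    rcases hu.lt_or_eq with hu | rfl
    · exact (hlt u hu).le.trans hT
    · exact le_rfl
  rw [add_comm n]
  -- The zeroth times are both `0` and do not differ by `T`, so the induction has to start from the
  -- first drawdown times on both sides.
  refine drawdownTime_add_shift ha hw hm (drawdownTime_succ_shift ha hw hm fun t _ => ⟨?_, ?_⟩) n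
  · rintro ⟨u, hut, -, hM⟩
    have : T ≤ u := not_lt.1 fun hu => ((le_max_left _ _).trans hM).not_gt (hlt u hu)
    obtain ⟨v, rfl⟩ := exists_add_of_le this
    exact ⟨v, hut, zero_le, hM⟩
  · rintro ⟨v, hv, -, hM⟩
    exact ⟨T + v, hv, zero_le, hM⟩

theorem runningMax_eq_of_lt_firstPassage_Ioc (hw : IsStepPath w) {t : ℝ≥0}
    (h : t < firstPassage (Ioc (y - a) y) w) : runningMax y w t = y :=
  le_antisymm (hw.runningMax_le_iff.2 ⟨le_rfl, fun _ hu =>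
    (mem_of_lt_firstPassage hw ((ENNReal.coe_le_coe.2 hu).trans_lt h)).2⟩) (le_max_left _ _)

theorem not_drawdown_of_lt_firstPassage_Ioc (hw : IsStepPath w) {t : ℝ≥0}
    (h : t < firstPassage (Ioc (y - a) y) w) : ¬ a ≤ runningMax y w t - w t := by
  rw [runningMax_eq_of_lt_firstPassage_Ioc hw h]
  have := (mem_of_lt_firstPassage hw h).1
  linarith

theorem drawdownTime_eq_top_of_firstPassage_Ioc (ha : 0 < a) (hw : IsStepPath w)
    (h : firstPassage (Ioc (y - a) y) w = ∞) (n : ℕ) : drawdownTime a y w (n + 1) = ∞ :=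
  drawdownTime_succ_eq_top_of_forall ha hw fun _ _ _ hd =>
    (not_drawdown_of_lt_firstPassage_Ioc hw (h ▸ ENNReal.coe_lt_top) hd).elim

theorem drawdownTime_of_firstPassage_Ioc_of_le (ha : 0 < a) (hw : IsStepPath w) (h0 : w 0 = y)
    {T : ℝ≥0} (h : firstPassage (Ioc (y - a) y) w = T) (hT : w T ≤ y - a) (n : ℕ) :
    drawdownTime a y w (n + 1) = T + drawdownTime a y (fun s => w (T + s)) n := by
  have hlt : ∀ u < T, (u : ℝ≥0∞) < firstPassage (Ioc (y - a) y) w := fun u hu =>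
    h ▸ ENNReal.coe_lt_coe.2 hu
  have hM : runningMax y w T = y := by
    refine le_antisymm (hw.runningMax_le_iff.2 ⟨le_rfl, fun u hu => ?_⟩) (le_max_left _ _)
    rcases hu.lt_or_eq with hu | rfl
    · exact (mem_of_lt_firstPassage hw (hlt u hu)).2
    · linarith
  have hpos : 0 < T := by
    have := firstPassage_pos (A := Ioc (y - a) y) hw (by rw [h0]; constructor <;> linarith)
    rw [h] at this
    exact_mod_cast this
  have key : drawdownTime a y w 1 = T := by
    rw [drawdownTime_succ ha hw]
    apply le_antisymm
    · refine sInf_le ⟨T, ⟨by linarith, 0, hpos, zero_le, ?_⟩, rfl⟩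
      rw [runningMax_eq_of_lt_firstPassage_Ioc hw (hlt 0 hpos), h0]
    · refine le_sInf ?_
      rintro _ ⟨t, ⟨hd, -⟩, rfl⟩
      exact not_lt.1 fun ht => not_drawdown_of_lt_firstPassage_Ioc hw (ht.trans_eq h.symm) hd
  have := drawdownTime_add_shift (T := T) (m := y) (j := 0) (k := 1) ha hw
    (by rw [hM, max_eq_left]; linarith) (key.trans (by simp [drawdownTime])) n
  rwa [add_comm 1, zero_add] at this

theorem drawdownTime_of_firstPassage_Ioc_of_gt (ha : 0 < a) (hw : IsStepPath w)
    {T : ℝ≥0} (h : firstPassage (Ioc (y - a) y) w = T) (hT : y < w T) (n : ℕ) :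
    drawdownTime a y w (n + 1) = T + drawdownTime a (w T) (fun s => w (T + s)) (n + 1) := by
  have hlt : ∀ u < T, (u : ℝ≥0∞) < firstPassage (Ioc (y - a) y) w := fun u hu =>
    h ▸ ENNReal.coe_lt_coe.2 hu
  have hM : runningMax y w T = w T := by
    refine le_antisymm (hw.runningMax_le_iff.2 ⟨hT.le, fun u hu => ?_⟩) (hw.le_runningMax le_rfl)
    rcases hu.lt_or_eq with hu | rfl
    · exact (mem_of_lt_firstPassage hw (hlt u hu)).2.trans hT.le
    · exact le_rfl
  have hm : max (w T) (w T) = runningMax y w T := by rw [max_self, hM]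
  rw [add_comm n]
  refine drawdownTime_add_shift ha hw hm (drawdownTime_succ_shift ha hw hm fun t hd => ⟨?_, ?_⟩) n
  · rintro -
    have hTt : T ≤ t := not_lt.1 fun ht => not_drawdown_of_lt_firstPassage_Ioc hw (hlt t ht) hd
    -- The original visit may precede `T`; it is replaced by `T` itself, where the path is at a new
    -- maximum.
    refine ⟨0, ?_, zero_le, by rw [add_zero, hM]⟩
    rw [add_zero]
    refine lt_of_le_of_ne hTt ?_
    rintro rfl
    linarith
  · rintro ⟨v, hv, -, hv'⟩
    exact ⟨T + v, hv, zero_le, hv'⟩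

end Decomposition

/-! ### Measurability on path space -/

/-- The `S`-valued paths that are locally constant to the right. -/
abbrev StepPath (S : Finset ℝ) : Type :=
  {w : ℝ≥0 → S // ∀ t, ∀ᶠ s in 𝓝[≥] t, w s = w t}

theorem tendsto_add_nhdsGE (r t : ℝ≥0) : Tendsto (fun s => s + t) (𝓝[≥] r) (𝓝[≥] (r + t)) := by
  refine tendsto_nhdsWithin_iff.2 ⟨?_, ?_⟩
  · exact ((continuous_id.add continuous_const).tendsto r).mono_left nhdsWithin_le_nhds
  · filter_upwards [self_mem_nhdsWithin] with s hs
    exact add_le_add_left hs t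

namespace StepPath

variable {S : Finset ℝ}

theorem isStepPath (w : StepPath S) : IsStepPath fun t => (w.1 t : ℝ) where
  finite_range := S.finite_toSet.subset (by rintro _ ⟨t, rfl⟩; exact (w.1 t).2)
  eventually_eq t := (w.2 t).mono fun s hs => by rw [hs]

/-- The path after time `T`. -/
def shift (T : ℝ≥0) (w : StepPath S) : StepPath S :=
  ⟨fun t => w.1 (T + t), fun t => by
    have h := tendsto_add_nhdsGE t T
    simp only [add_comm _ T] at h
    exact h.eventually (w.2 (T + t))⟩

theorem shift_apply (T t : ℝ≥0) (w : StepPath S) : (w.shift T).1 t = w.1 (T + t) := rfl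

theorem shift_shift (s t : ℝ≥0) (w : StepPath S) : (w.shift s).shift t = w.shift (s + t) :=
  Subtype.ext (funext fun u => by simp only [shift_apply, add_assoc])

theorem shift_zero (w : StepPath S) : w.shift 0 = w :=
  Subtype.ext (funext fun u => by rw [shift_apply, zero_add])

theorem measurable_apply (t : ℝ≥0) : Measurable fun w : StepPath S => w.1 t :=
  (measurable_pi_apply t).comp measurable_subtype_coe

theorem measurable_shift (T : ℝ≥0) : Measurable (shift T : StepPath S → StepPath S) :=
  Measurable.subtype_mk (measurable_pi_lambda _ fun t => measurable_apply (T + t))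

theorem measurable_runningMax (y : ℝ) (t : ℝ≥0) :
    Measurable fun w : StepPath S => runningMax y (fun s => (w.1 s : ℝ)) t := by
  refine measurable_of_Iic fun c => ?_
  have : (fun w : StepPath S => runningMax y (fun s => (w.1 s : ℝ)) t) ⁻¹' Iic c =
      {_w | y ≤ c} ∩ {w | (w.1 t : ℝ) ≤ c} ∩ ⋂ i, {w |
        TopologicalSpace.denseSeq ℝ≥0 i < t → (w.1 (TopologicalSpace.denseSeq ℝ≥0 i) : ℝ) ≤ c} := by
    ext w
    simp only [mem_preimage, mem_Iic, w.isStepPath.runningMax_le_iff, mem_inter_iff, mem_iInter,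
      mem_ofPred_eq, and_assoc]
    refine and_congr_right fun _ => ⟨fun h => ⟨h t le_rfl, fun i hi => h _ hi.le⟩, ?_⟩
    rintro ⟨ht, h⟩ u hu
    rcases hu.lt_or_eq with hu | rfl
    · obtain ⟨r, hur, hrt, hr⟩ := w.isStepPath.exists_Ico hu
      obtain ⟨_, ⟨i, rfl⟩, hi⟩ := (TopologicalSpace.denseRange_denseSeq ℝ≥0).exists_between hur
      exact (hr _ ⟨hi.1.le, hi.2⟩).symm.trans_le (h i (hi.2.trans_le hrt))
    · exact ht
  rw [this]
  refine ((MeasurableSet.const _).inter ?_).inter (MeasurableSet.iInter fun i => ?_)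
  · exact measurableSet_le (measurable_subtype_coe.comp (measurable_apply t)) measurable_const
  · refine (MeasurableSet.const _).imp (measurableSet_le ?_ measurable_const)
    exact measurable_subtype_coe.comp (measurable_apply _)

end StepPath

/-- Both the drawdown time and the visit to the maximum can be moved slightly to the right, into the
dense sequence, without changing the path value or the running maximum. Measurability follows by
induction on `n`. -/
theorem drawdownTime_succ_lt_iff {a y : ℝ} {w : ℝ≥0 → ℝ} (ha : 0 < a) (hw : IsStepPath w) (n : ℕ)
    {c : ℝ≥0∞} : drawdownTime a y w (n + 1) < c ↔ ∃ i j,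
      TopologicalSpace.denseSeq ℝ≥0 i < TopologicalSpace.denseSeq ℝ≥0 j ∧
      (TopologicalSpace.denseSeq ℝ≥0 j : ℝ≥0∞) < c ∧
      a ≤ runningMax y w (TopologicalSpace.denseSeq ℝ≥0 j) - w (TopologicalSpace.denseSeq ℝ≥0 j) ∧
      drawdownTime a y w n ≤ TopologicalSpace.denseSeq ℝ≥0 i ∧
      runningMax y w (TopologicalSpace.denseSeq ℝ≥0 i) ≤ w (TopologicalSpace.denseSeq ℝ≥0 i) := by
  rw [drawdownTime_succ ha hw]
  constructor
  · intro h
    obtain ⟨_, ⟨t, ⟨hd, u, hut, hu, hM⟩, rfl⟩, htc⟩ := sInf_lt_iff.1 h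
    obtain ⟨c', htc', hc'⟩ := ENNReal.lt_iff_exists_nnreal_btwn.1 htc
    have approx : ∀ {s b : ℝ≥0}, s < b → ∃ i, s ≤ TopologicalSpace.denseSeq ℝ≥0 i ∧
        TopologicalSpace.denseSeq ℝ≥0 i < b ∧ w (TopologicalSpace.denseSeq ℝ≥0 i) = w s ∧
        runningMax y w (TopologicalSpace.denseSeq ℝ≥0 i) = runningMax y w s := by
      intro s b hsb
      obtain ⟨r, hsr, hrb, hr⟩ := hw.exists_Ico hsb
      obtain ⟨_, ⟨i, rfl⟩, hi⟩ := (TopologicalSpace.denseRange_denseSeq ℝ≥0).exists_between hsr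
      exact ⟨i, hi.1.le, hi.2.trans_le hrb, hr _ ⟨hi.1.le, hi.2⟩,
        hw.runningMax_eq_of_const hi.1.le fun v hv => hr v ⟨hv.1, hv.2.trans_lt hi.2⟩⟩
    obtain ⟨i, hi, hit, hiw, hiM⟩ := approx hut
    obtain ⟨j, hj, hjc, hjw, hjM⟩ := approx (ENNReal.coe_lt_coe.1 htc')
    refine ⟨i, j, hit.trans_le hj, (ENNReal.coe_lt_coe.2 hjc).trans hc', ?_,
      hu.trans (ENNReal.coe_le_coe.2 hi), ?_⟩
    · rwa [hjw, hjM]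
    · rwa [hiw, hiM]
  · rintro ⟨i, j, hij, hj, hd, hi, hM⟩
    have hmem : _ ∈ drawdownSet a y w _ := ⟨hd, _, hij, hi, hM⟩
    exact (sInf_le (mem_image_of_mem _ hmem)).trans_lt hj

theorem measurable_drawdownTime {S : Finset ℝ} {a : ℝ} (ha : 0 < a) (y : ℝ) (n : ℕ) :
    Measurable fun w : StepPath S => drawdownTime a y (fun t => (w.1 t : ℝ)) n := by
  induction n with
  | zero => exact measurable_const
  | succ n ih =>
    have hval : ∀ t, Measurable fun w : StepPath S => (w.1 t : ℝ) := fun t =>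
      measurable_subtype_coe.comp (StepPath.measurable_apply t)
    refine measurable_of_Iio fun c => ?_
    simp only [preimage, mem_Iio, drawdownTime_succ_lt_iff ha (StepPath.isStepPath _)]
    simp only [ofPred_exists]
    refine MeasurableSet.iUnion fun i => MeasurableSet.iUnion fun j => ?_
    refine (MeasurableSet.const _).inter ((MeasurableSet.const _).inter (.inter ?_ (.inter ?_ ?_)))
    · exact measurableSet_le measurable_const ((StepPath.measurable_runningMax y _).sub (hval _))
    · exact measurableSet_le ih measurable_const
    · exact measurableSet_le (StepPath.measurable_runningMax y _) (hval _)

/-! ### Discount factors -/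

theorem measurable_discount (q : ℂ) : Measurable (discount q) :=
  Measurable.ite (measurableSet_singleton ∞) measurable_const
    (Complex.measurable_exp.comp (measurable_const.mul
      (Complex.measurable_ofReal.comp ENNReal.measurable_toReal)))

theorem discount_add (q : ℂ) (T : ℝ≥0) (D : ℝ≥0∞) :
    discount q (T + D) = discount q T * discount q D := by
  unfold discount
  by_cases h : D = ∞
  · simp [h]
  · rw [if_neg (ENNReal.add_ne_top.2 ⟨ENNReal.coe_ne_top, h⟩), if_neg ENNReal.coe_ne_top, if_neg h,
      ENNReal.toReal_add ENNReal.coe_ne_top h, ← Complex.exp_add]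
    push_cast
    ring_nf

theorem norm_discount (q : ℂ) (T : ℝ≥0∞) :
    ‖discount q T‖ = if T = ∞ then 0 else Real.exp (-(q.re * T.toReal)) := by
  unfold discount
  split_ifs
  · simp
  · rw [Complex.norm_exp]
    simp

theorem norm_discount_le_one {q : ℂ} (hq : 0 < q.re) (T : ℝ≥0∞) : ‖discount q T‖ ≤ 1 := by
  rw [norm_discount]
  split_ifs
  · exact zero_le_one
  · exact Real.exp_le_one_iff.2 (neg_nonpos.2 (by positivity))

theorem norm_discount_lt_one {q : ℂ} (hq : 0 < q.re) {T : ℝ≥0∞} (hT : 0 < T) :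
    ‖discount q T‖ < 1 := by
  rw [norm_discount]
  split_ifs with h
  · exact zero_lt_one
  · exact Real.exp_lt_one_iff.2 (neg_neg_of_pos (mul_pos hq (ENNReal.toReal_pos hT.ne' h)))

/-! ### Cylinders as a generating π-system -/

namespace StepPath

variable {S : Finset ℝ}

/-- The paths that pass through the listed states, the times being given by their increments. -/
def cylinder : List (ℝ≥0 × S) → Set (StepPath S)
  | [] => univ
  | (t, z) :: L => {w | w.1 t = z ∧ w.shift t ∈ cylinder L}

theorem mem_cylinder_cons {t : ℝ≥0} {z : S} {L : List (ℝ≥0 × S)} {w : StepPath S} :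
    w ∈ cylinder ((t, z) :: L) ↔ w.1 t = z ∧ w.shift t ∈ cylinder L := Iff.rfl

theorem measurableSet_cylinder (L : List (ℝ≥0 × S)) : MeasurableSet (cylinder L) := by
  induction L with
  | nil => exact MeasurableSet.univ
  | cons p L ih =>
    exact (measurable_apply p.1 (measurableSet_singleton p.2)).inter (measurable_shift p.1 ih)

/-- The two lists are merged in order of time: the earlier head comes first, and the other head
keeps the remaining increment. -/
theorem cylinder_inter_cylinder (L L' : List (ℝ≥0 × S)) :
    ∃ L'', cylinder L ∩ cylinder L' = cylinder L'' := by
  have key : ∀ {t t' : ℝ≥0} {z z' : S} {L L' : List (ℝ≥0 × S)}, t ≤ t' →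
      (∃ M, cylinder L ∩ cylinder ((t' - t, z') :: L') = cylinder M) →
      ∃ M, cylinder ((t, z) :: L) ∩ cylinder ((t', z') :: L') = cylinder M := by
    rintro t t' z z' L L' h ⟨M, hM⟩
    refine ⟨(t, z) :: M, ?_⟩
    ext w
    rw [mem_cylinder_cons, ← hM]
    simp only [mem_inter_iff, mem_cylinder_cons, shift_apply, shift_shift,
      add_tsub_cancel_of_le h, and_assoc]
  induction hn : L.length + L'.length using Nat.strong_induction_on generalizing L L' with
  | _ n ih =>
  match L, L' with
  | [], L' => exact ⟨L', univ_inter _⟩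
  | L, [] => exact ⟨L, inter_univ _⟩
  | (t, z) :: L, (t', z') :: L' =>
    simp only [List.length_cons] at hn
    rcases le_total t t' with h | h
    · exact key h (ih _ (by simp only [List.length_cons]; omega) _ _ rfl)
    · rw [inter_comm]
      exact key h (ih _ (by simp only [List.length_cons]; omega) _ _ rfl)

theorem isPiSystem_range_cylinder : IsPiSystem (range (cylinder (S := S))) := by
  rintro _ ⟨L, rfl⟩ _ ⟨L', rfl⟩ -
  obtain ⟨M, hM⟩ := cylinder_inter_cylinder L L'
  exact ⟨M, hM.symm⟩

theorem generateFrom_range_cylinder :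
    MeasurableSpace.generateFrom (range (cylinder (S := S))) =
      (inferInstance : MeasurableSpace (StepPath S)) := by
  refine le_antisymm (MeasurableSpace.generateFrom_le ?_) ?_
  · rintro _ ⟨L, rfl⟩
    exact measurableSet_cylinder L
  · let m := MeasurableSpace.generateFrom (range (cylinder (S := S)))
    have : Measurable[m] (Subtype.val : StepPath S → ℝ≥0 → S) := by
      refine measurable_pi_lambda _ fun t => measurable_to_countable' fun z => ?_
      refine MeasurableSpace.measurableSet_generateFrom ⟨[(t, z)], ?_⟩
      ext w
      exact and_iff_left trivial
    exact this.comap_le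

/-- This right-continuity carries the Markov property from grid times to their limit. -/
theorem eventually_shift_mem_cylinder (w : StepPath S) (r : ℝ≥0) (L : List (ℝ≥0 × S)) :
    ∀ᶠ s in 𝓝[≥] r, (w.shift s ∈ cylinder L ↔ w.shift r ∈ cylinder L) := by
  induction L generalizing r with
  | nil => exact Eventually.of_forall fun _ => Iff.rfl
  | cons p L ih =>
    obtain ⟨t, z⟩ := p
    filter_upwards [(tendsto_add_nhdsGE r t).eventually ((w.2 (r + t)).and (ih (r + t)))]
      with s hs
    rw [mem_cylinder_cons, mem_cylinder_cons, shift_apply, shift_apply, shift_shift, shift_shift,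
      hs.1, hs.2]

end StepPath

/-! ### Strong Markov property at optional times -/

/-- The first multiple of `1 / (n + 1)` after `r`. -/
noncomputable def gridTime (n : ℕ) (r : ℝ≥0) : ℝ≥0 := (⌊(n + 1) * r⌋₊ + 1) / (n + 1)

theorem lt_gridTime (n : ℕ) (r : ℝ≥0) : r < gridTime n r := by
  rw [gridTime, lt_div_iff₀ (by positivity), mul_comm]
  exact Nat.lt_floor_add_one _

theorem gridTime_le (n : ℕ) (r : ℝ≥0) : gridTime n r ≤ r + 1 / (n + 1) := by
  rw [gridTime, add_div]
  gcongr
  rw [div_le_iff₀ (by positivity), mul_comm]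
  exact Nat.floor_le zero_le

theorem tendsto_gridTime (r : ℝ≥0) : Tendsto (fun n => gridTime n r) atTop (𝓝[≥] r) := by
  refine tendsto_nhdsWithin_iff.2 ⟨?_, Eventually.of_forall fun n => (lt_gridTime n r).le⟩
  refine tendsto_of_tendsto_of_tendsto_of_le_of_le tendsto_const_nhds ?_
    (fun n => (lt_gridTime n r).le) fun n => gridTime_le n r
  have : Tendsto (fun n : ℕ => 1 / ((n : ℝ≥0) + 1)) atTop (𝓝 0) := by
    exact_mod_cast tendsto_one_div_add_atTop_nhds_zero_nat (𝕜 := ℝ≥0)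
  simpa using tendsto_const_nhds.add this

namespace IsCTMC

variable {Ω : Type*} [MeasurableSpace Ω] {S : Finset ℝ} {G : Matrix S S ℝ} {P : S → Measure Ω}
  {Y : ℝ≥0 → Ω → S}

/-- The chain as a random step path. -/
def path (hY : IsCTMC G P Y) (ω : Ω) : StepPath S :=
  ⟨fun t => Y t ω, fun t => by
    have := hY.right_continuous ω t
    rw [ContinuousWithinAt, nhds_discrete] at this
    exact tendsto_pure.1 this⟩

theorem path_apply (hY : IsCTMC G P Y) (ω : Ω) (t : ℝ≥0) : (hY.path ω).1 t = Y t ω := rfl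

theorem measurable_path (hY : IsCTMC G P Y) : Measurable hY.path :=
  Measurable.subtype_mk (measurable_pi_lambda _ hY.measurable)

theorem past_le (hY : IsCTMC G P Y) (s : ℝ≥0) :
    (⨆ u ∈ Iic s, MeasurableSpace.comap (Y u) inferInstance) ≤ (inferInstance : MeasurableSpace Ω) :=
  iSup₂_le fun u _ => (hY.measurable u).comap_le

/-- The probability of a cylinder under the chain started from `y`. -/
noncomputable def cylinderWeight (G : Matrix S S ℝ) : S → List (ℝ≥0 × S) → ℝ
  | _, [] => 1
  | y, (t, z) :: L => NormedSpace.exp ((t : ℝ) • G) y z * cylinderWeight G z L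

/-- By induction on the list: the event at time `s` is absorbed into the past of the next time, and
the Markov property supplies one factor. -/
theorem measureReal_cylinder (hY : IsCTMC G P Y) (x : S) (L : List (ℝ≥0 × S)) (s : ℝ≥0) {A : Set Ω}
    (hA : MeasurableSet[⨆ u ∈ Iic s, MeasurableSpace.comap (Y u) inferInstance] A) (y : S) :
    (P x).real (A ∩ {ω | Y s ω = y} ∩ {ω | (hY.path ω).shift s ∈ StepPath.cylinder L}) =
      (P x).real (A ∩ {ω | Y s ω = y}) * cylinderWeight G y L := by
  induction L generalizing s A y with
  | nil => simp [StepPath.cylinder, cylinderWeight]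
  | cons p L ih =>
    obtain ⟨t, z⟩ := p
    have hA' : MeasurableSet[⨆ u ∈ Iic (s + t), MeasurableSpace.comap (Y u) inferInstance]
        (A ∩ {ω | Y s ω = y}) := by
      refine MeasurableSet.inter ?_ ?_
      · exact (biSup_mono fun u (hu : u ≤ s) => hu.trans le_self_add :
          (⨆ u ∈ Iic s, MeasurableSpace.comap (Y u) inferInstance) ≤ _) _ hA
      · exact (le_biSup (fun u => MeasurableSpace.comap (Y u) inferInstance)
          (mem_Iic.2 (le_self_add : s ≤ s + t))) _ ⟨{y}, measurableSet_singleton y, rfl⟩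
    have := ih (s + t) hA' z
    rw [hY.markov x s t A hA y z, mul_assoc] at this
    rw [cylinderWeight, ← this]
    congr 1
    ext ω
    simp only [mem_inter_iff, mem_ofPred_eq, StepPath.mem_cylinder_cons, StepPath.shift_shift,
      StepPath.shift_apply, path_apply, and_assoc]

theorem measure_path_cylinder (hY : IsCTMC G P Y) (x : S) (L : List (ℝ≥0 × S)) :
    (P x).real (hY.path ⁻¹' StepPath.cylinder L) = cylinderWeight G x L := by
  have := hY.prob x
  have h := hY.measureReal_cylinder x L 0 MeasurableSet.univ x
  simp only [StepPath.shift_zero, univ_inter] at h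
  have h1 : (P x).real {ω | Y 0 ω = x} = 1 := by
    rw [measureReal_congr (eventuallyEq_univ.2 (hY.start x)), probReal_univ]
  rw [h1, one_mul] at h
  rw [← h]
  refine measureReal_congr ?_
  filter_upwards [hY.start x] with ω hω
  exact propext (and_iff_right hω).symm

/-- The weight does not depend on `s` or `x`, and at `s = 0` it is a probability under `P y`. The
entry `(0, y)` with zero increment records the current state. -/
theorem measure_cylinder (hY : IsCTMC G P Y) (x : S) (L : List (ℝ≥0 × S)) (s : ℝ≥0) {A : Set Ω}
    (hA : MeasurableSet[⨆ u ∈ Iic s, MeasurableSpace.comap (Y u) inferInstance] A) (y : S) :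
    P x (A ∩ {ω | (hY.path ω).shift s ∈ StepPath.cylinder ((0, y) :: L)}) =
      P x (A ∩ {ω | (hY.path ω).shift s ∈ StepPath.cylinder [(0, y)]}) *
        P y (hY.path ⁻¹' StepPath.cylinder L) := by
  have := hY.prob
  have h := hY.measureReal_cylinder x L s hA y
  rw [← hY.measure_path_cylinder y L] at h
  simp only [measureReal_def, ← ENNReal.toReal_mul] at h
  rw [ENNReal.toReal_eq_toReal_iff' (measure_ne_top _ _)
    (ENNReal.mul_ne_top (measure_ne_top _ _) (measure_ne_top _ _))] at h
  have e : ∀ L, {ω | (hY.path ω).shift s ∈ StepPath.cylinder ((0, y) :: L)} =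
      {ω | Y s ω = y} ∩ {ω | (hY.path ω).shift s ∈ StepPath.cylinder L} := fun L => by
    ext ω
    simp only [mem_inter_iff, mem_ofPred_eq, StepPath.mem_cylinder_cons, StepPath.shift_shift,
      StepPath.shift_apply, add_zero, path_apply]
  have e' : {ω | (hY.path ω).shift s ∈ StepPath.cylinder ([] : List (ℝ≥0 × S))} = univ :=
    eq_univ_of_forall fun ω => mem_univ _
  rw [e, e, e', inter_univ, ← h, inter_assoc]

section OptionalTime

variable {τ : Ω → ℝ≥0∞}

theorem measurable_of_optionalTime (hY : IsCTMC G P Y)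
    (hτ : ∀ c : ℝ≥0, MeasurableSet[⨆ u ∈ Iic c, MeasurableSpace.comap (Y u) inferInstance]
      {ω | τ ω < c}) : Measurable τ := by
  have h : ∀ c : ℝ≥0, MeasurableSet {ω | τ ω < c} := fun c => hY.past_le c _ (hτ c)
  refine measurable_of_Iio fun c => ?_
  induction c using ENNReal.recTopCoe with
  | coe c => exact h c
  | top =>
    have : τ ⁻¹' Iio ∞ = ⋃ n : ℕ, {ω | τ ω < (n : ℝ≥0)} := by
      ext ω
      simp only [mem_preimage, mem_Iio, mem_iUnion, mem_ofPred_eq, ENNReal.coe_natCast]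
      exact ⟨fun h => ENNReal.exists_nat_gt h.ne, fun ⟨n, hn⟩ => hn.trans (ENNReal.natCast_lt_top n)⟩
    rw [this]
    exact MeasurableSet.iUnion fun n => h n

/-- Since `gridTime` lies strictly after `τ`, its value `(k + 1) / (n + 1)` is decided by events of
the form `τ < c` up to that time. -/
theorem setOf_gridTime_eq (hY : IsCTMC G P Y) (n : ℕ) (c : ℝ≥0) (L : List (ℝ≥0 × S)) :
    {ω | τ ω ≠ ∞ ∧ gridTime n (τ ω).toNNReal < c ∧
      (hY.path ω).shift (gridTime n (τ ω).toNNReal) ∈ StepPath.cylinder L} =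
    ⋃ k : ℕ, {ω | ((k + 1 : ℝ≥0) / (n + 1) < c ∧ τ ω < ((k + 1 : ℝ≥0) / (n + 1) : ℝ≥0)) ∧
      ¬ τ ω < ((k : ℝ≥0) / (n + 1) : ℝ≥0)} ∩
      {ω | (hY.path ω).shift ((k + 1 : ℝ≥0) / (n + 1)) ∈ StepPath.cylinder L} := by
  ext ω
  have hpos : (0 : ℝ≥0) < n + 1 := by positivity
  simp only [mem_ofPred_eq, mem_iUnion, mem_inter_iff]
  constructor
  · rintro ⟨h, hc, hL⟩
    refine ⟨⌊((n : ℝ≥0) + 1) * (τ ω).toNNReal⌋₊, ⟨⟨hc, ?_⟩, ?_⟩, hL⟩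
    · rw [← ENNReal.coe_toNNReal h, ENNReal.coe_lt_coe, ENNReal.toNNReal_coe]
      exact lt_gridTime n _
    · rw [← ENNReal.coe_toNNReal h, ENNReal.coe_lt_coe, ENNReal.toNNReal_coe, not_lt,
        div_le_iff₀ hpos, mul_comm]
      exact Nat.floor_le zero_le
  · rintro ⟨k, ⟨⟨hc, h1⟩, h2⟩, hL⟩
    have h : τ ω ≠ ∞ := (h1.trans ENNReal.coe_lt_top).ne
    have hg : gridTime n (τ ω).toNNReal = (k + 1) / (n + 1) := by
      rw [← ENNReal.coe_toNNReal h, ENNReal.coe_lt_coe, lt_div_iff₀ hpos] at h1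
      rw [← ENNReal.coe_toNNReal h, ENNReal.coe_lt_coe, not_lt, div_le_iff₀ hpos] at h2
      rw [gridTime, (Nat.floor_eq_iff zero_le).2 ⟨mul_comm _ (n + 1 : ℝ≥0) ▸ h2,
        mul_comm _ (n + 1 : ℝ≥0) ▸ h1⟩]
    rw [hg]
    exact ⟨h, hc, hL⟩

omit [MeasurableSpace Ω] in
theorem measurableSet_grid (hτ : ∀ c : ℝ≥0,
      MeasurableSet[⨆ u ∈ Iic c, MeasurableSpace.comap (Y u) inferInstance] {ω | τ ω < c})
    (n k : ℕ) (c : ℝ≥0) :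
    MeasurableSet[⨆ u ∈ Iic ((k + 1 : ℝ≥0) / (n + 1)), MeasurableSpace.comap (Y u) inferInstance]
      {ω | ((k + 1 : ℝ≥0) / (n + 1) < c ∧ τ ω < ((k + 1 : ℝ≥0) / (n + 1) : ℝ≥0)) ∧
        ¬ τ ω < ((k : ℝ≥0) / (n + 1) : ℝ≥0)} := by
  refine MeasurableSet.inter (MeasurableSet.inter (MeasurableSet.const _) (hτ _))
    (MeasurableSet.compl ?_)
  refine (biSup_mono fun u (hu : u ≤ (k : ℝ≥0) / (n + 1)) => hu.trans ?_ :
    (⨆ u ∈ Iic ((k : ℝ≥0) / (n + 1)), MeasurableSpace.comap (Y u) inferInstance) ≤ _) _ (hτ _)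
  gcongr
  exact le_self_add

/-- The state at a random time is the limit of the states at grid times, which take countably many
values. -/
theorem measurable_shift_path (hY : IsCTMC G P Y) {r : Ω → ℝ≥0} (hr : Measurable r) :
    Measurable fun ω => (hY.path ω).shift (r ω) := by
  refine Measurable.subtype_mk (measurable_pi_lambda _ fun t => ?_)
  refine measurable_of_tendsto_metrizable (f := fun n ω => Y (gridTime n (r ω) + t) ω)
    (fun n => ?_) (tendsto_pi_nhds.2 fun ω => ?_)
  · have h : ∀ g : ℕ → ℝ≥0, Measurable fun p : ℕ × Ω => Y (g p.1) p.2 := fun g =>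
      measurable_from_prod_countable_right fun k => hY.measurable (g k)
    have hf : Measurable fun ω => ⌊((n : ℝ≥0) + 1) * r ω⌋₊ :=
      Nat.measurable_floor.comp (hr.const_mul _)
    have h' := (h fun k => (k + 1) / (n + 1) + t).comp (hf.prodMk measurable_id)
    have e : (fun ω => Y (gridTime n (r ω) + t) ω) =
        (fun p : ℕ × Ω => Y ((fun k : ℕ => ((k : ℝ≥0) + 1) / (n + 1) + t) p.1) p.2) ∘
          fun ω => (⌊((n : ℝ≥0) + 1) * r ω⌋₊, ω) := by
      funext ω
      simp only [Function.comp_apply, gridTime]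
    rw [e]
    exact h'
  · have h := (hY.right_continuous ω (r ω + t)).tendsto
    exact h.comp ((tendsto_add_nhdsGE (r ω) t).comp (tendsto_gridTime (r ω)))

/-- The fixed-time Markov property applies on each grid cell; summing over cells and refining the
grid gives the claim. -/
theorem measure_optionalTime (hY : IsCTMC G P Y)
    (hτ : ∀ c : ℝ≥0, MeasurableSet[⨆ u ∈ Iic c, MeasurableSpace.comap (Y u) inferInstance]
      {ω | τ ω < c}) (x z : S) (c : ℝ≥0) (L : List (ℝ≥0 × S)) :
    P x {ω | τ ω < c ∧ (hY.path ω).shift (τ ω).toNNReal ∈ StepPath.cylinder ((0, z) :: L)} =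
      P x {ω | τ ω < c ∧ (hY.path ω).shift (τ ω).toNNReal ∈ StepPath.cylinder [(0, z)]} *
        P z (hY.path ⁻¹' StepPath.cylinder L) := by
  have := hY.prob
  have hm : ∀ (n k : ℕ) L, MeasurableSet ({ω | ((k + 1 : ℝ≥0) / (n + 1) < c ∧
      τ ω < ((k + 1 : ℝ≥0) / (n + 1) : ℝ≥0)) ∧ ¬ τ ω < ((k : ℝ≥0) / (n + 1) : ℝ≥0)} ∩
      {ω | (hY.path ω).shift ((k + 1 : ℝ≥0) / (n + 1)) ∈ StepPath.cylinder L}) := fun n k L =>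
    (hY.past_le _ _ (measurableSet_grid hτ n k c)).inter
      (((StepPath.measurable_shift _).comp hY.measurable_path)
        (StepPath.measurableSet_cylinder L))
  have hlim : ∀ L, Tendsto (fun n => P x {ω | τ ω ≠ ∞ ∧ gridTime n (τ ω).toNNReal < c ∧
      (hY.path ω).shift (gridTime n (τ ω).toNNReal) ∈ StepPath.cylinder L}) atTop
      (𝓝 (P x {ω | τ ω < c ∧ (hY.path ω).shift (τ ω).toNNReal ∈ StepPath.cylinder L})) := by
    intro L
    refine tendsto_measure_of_tendsto_indicator_of_isFiniteMeasure atTop (P x) (fun n => ?_)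
      fun ω => ?_
    · rw [hY.setOf_gridTime_eq]
      exact MeasurableSet.iUnion fun k => hm n k L
    · by_cases h : τ ω = ∞
      · simp [h]
      obtain ⟨r, hr⟩ : ∃ r : ℝ≥0, (r : ℝ≥0∞) = τ ω := ⟨_, ENNReal.coe_toNNReal h⟩
      have ht := tendsto_gridTime r
      -- Grid times decrease to `r` from strictly above, so even `r = c` causes no jump of the
      -- indicator.
      have hc : ∀ᶠ n in atTop, gridTime n r < c ↔ r < c := by
        by_cases hrc : r < c
        · exact ((tendsto_nhds_of_tendsto_nhdsWithin ht).eventually_lt_const hrc).mono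
            fun n hn => iff_of_true hn hrc
        · exact Eventually.of_forall fun n =>
            iff_of_false (fun hn => hrc ((lt_gridTime n r).trans hn)) hrc
      filter_upwards [hc, ht.eventually ((hY.path ω).eventually_shift_mem_cylinder r L)]
        with n h1 h2
      simp only [← hr, ENNReal.toNNReal_coe, ENNReal.coe_lt_coe, h1, h2, ne_eq,
        ENNReal.coe_ne_top, not_false_eq_true, true_and]
  have hdisj : ∀ (n : ℕ) L, Pairwise (Function.onFun Disjoint fun k : ℕ => {ω |
      ((k + 1 : ℝ≥0) / (n + 1) < c ∧ τ ω < ((k + 1 : ℝ≥0) / (n + 1) : ℝ≥0)) ∧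
      ¬ τ ω < ((k : ℝ≥0) / (n + 1) : ℝ≥0)} ∩
      {ω | (hY.path ω).shift ((k + 1 : ℝ≥0) / (n + 1)) ∈ StepPath.cylinder L}) := by
    intro n L
    refine (pairwise_disjoint_on _).2 fun k l hkl => disjoint_left.2 ?_
    rintro ω ⟨⟨⟨-, h1⟩, -⟩, -⟩ ⟨⟨-, h2⟩, -⟩
    refine h2 (h1.trans_le (ENNReal.coe_le_coe.2 ?_))
    gcongr
    exact_mod_cast hkl
  refine tendsto_nhds_unique (hlim _) ?_
  refine (ENNReal.Tendsto.mul_const (hlim [(0, z)]) (Or.inr (measure_ne_top _ _))).congr fun n => ?_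
  rw [hY.setOf_gridTime_eq, hY.setOf_gridTime_eq, measure_iUnion (hdisj n _) fun k => hm n k _,
    measure_iUnion (hdisj n _) fun k => hm n k _, ← ENNReal.tsum_mul_right]
  exact tsum_congr fun k => (hY.measure_cylinder x L _ (measurableSet_grid hτ n k c) z).symm

/-- Strong Markov property: at an optional time the chain starts afresh. -/
theorem map_optionalTime_eq_prod (hY : IsCTMC G P Y)
    (hτ : ∀ c : ℝ≥0, MeasurableSet[⨆ u ∈ Iic c, MeasurableSpace.comap (Y u) inferInstance]
      {ω | τ ω < c}) (x z : S) :
    ((P x).restrict {ω | τ ω ≠ ∞ ∧ Y (τ ω).toNNReal ω = z}).map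
        (fun ω => ((τ ω).toNNReal, (hY.path ω).shift (τ ω).toNNReal)) =
      (((P x).restrict {ω | τ ω ≠ ∞ ∧ Y (τ ω).toNNReal ω = z}).map fun ω => (τ ω).toNNReal).prod
        ((P z).map hY.path) := by
  have := hY.prob
  have hr : Measurable fun ω => (τ ω).toNNReal := (hY.measurable_of_optionalTime hτ).ennreal_toNNReal
  have hs := hY.measurable_shift_path hr
  have := Measure.isProbabilityMeasure_map (μ := P z) hY.measurable_path.aemeasurable
  have hset : ∀ c L, {ω | (τ ω).toNNReal < c ∧ (hY.path ω).shift (τ ω).toNNReal ∈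
      StepPath.cylinder L} ∩ {ω | τ ω ≠ ∞ ∧ Y (τ ω).toNNReal ω = z} = {ω | τ ω < c ∧
        (hY.path ω).shift (τ ω).toNNReal ∈ StepPath.cylinder ((0, z) :: L)} := by
    intro c L
    ext ω
    simp only [mem_inter_iff, mem_ofPred_eq, StepPath.mem_cylinder_cons, StepPath.shift_shift,
      StepPath.shift_apply, add_zero, path_apply]
    constructor
    · rintro ⟨⟨h1, h2⟩, h, h3⟩
      exact ⟨by rwa [← ENNReal.coe_toNNReal h, ENNReal.coe_lt_coe], h3, h2⟩
    · rintro ⟨h1, h3, h2⟩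
      have h : τ ω ≠ ∞ := (h1.trans ENNReal.coe_lt_top).ne
      rw [← ENNReal.coe_toNNReal h, ENNReal.coe_lt_coe] at h1
      exact ⟨⟨h1, h2⟩, h, h3⟩
  symm
  -- It suffices to compare rectangles `Iio c ×ˢ cylinder L`.
  refine Measure.prod_eq_generateFrom (C := range (Iio : ℝ≥0 → Set ℝ≥0))
    (D := range (StepPath.cylinder (S := S))) (borel_eq_generateFrom_Iio ℝ≥0 ▸
      BorelSpace.measurable_eq.symm) StepPath.generateFrom_range_cylinder isPiSystem_Iio
    StepPath.isPiSystem_range_cylinder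
    ⟨fun n => Iio n, fun n => ⟨_, rfl⟩, fun n => measure_lt_top _ _, ?_⟩
    ⟨fun _ => univ, fun _ => ⟨[], rfl⟩, fun n => measure_lt_top _ _, iUnion_const _⟩ ?_
  · exact eq_univ_of_forall fun r => mem_iUnion.2 (exists_nat_gt r)
  · rintro _ ⟨c, rfl⟩ _ ⟨L, rfl⟩
    have hL := StepPath.measurableSet_cylinder L
    rw [Measure.map_apply (hr.prodMk hs) (measurableSet_Iio.prod hL),
      Measure.map_apply hr measurableSet_Iio, Measure.map_apply hY.measurable_path hL,
      Measure.restrict_apply ((hr.prodMk hs) (measurableSet_Iio.prod hL)),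
      Measure.restrict_apply (hr measurableSet_Iio)]
    have h0 : (fun ω => (τ ω).toNNReal) ⁻¹' Iio c ∩ {ω | τ ω ≠ ∞ ∧ Y (τ ω).toNNReal ω = z} =
        {ω | τ ω < c ∧ (hY.path ω).shift (τ ω).toNNReal ∈ StepPath.cylinder [(0, z)]} := by
      rw [← hset c []]
      congr 1
      ext ω
      exact (and_iff_left (mem_univ _)).symm
    refine (congrArg (P x) (hset c L)).trans ((hY.measure_optionalTime hτ x z c L).trans ?_)
    rw [h0]

theorem setIntegral_optionalTime (hY : IsCTMC G P Y)
    (hτ : ∀ c : ℝ≥0, MeasurableSet[⨆ u ∈ Iic c, MeasurableSpace.comap (Y u) inferInstance]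
      {ω | τ ω < c}) (x z : S) {g : ℝ≥0 → ℂ} (hg : Measurable g) {F : StepPath S → ℂ}
    (hF : Measurable F) :
    ∫ ω in {ω | τ ω ≠ ∞ ∧ Y (τ ω).toNNReal ω = z},
        g (τ ω).toNNReal * F ((hY.path ω).shift (τ ω).toNNReal) ∂(P x) =
      (∫ ω in {ω | τ ω ≠ ∞ ∧ Y (τ ω).toNNReal ω = z}, g (τ ω).toNNReal ∂(P x)) *
        ∫ ω, F (hY.path ω) ∂(P z) := by
  have := hY.prob
  have hr : Measurable fun ω => (τ ω).toNNReal := (hY.measurable_of_optionalTime hτ).ennreal_toNNReal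
  have := Measure.isProbabilityMeasure_map (μ := P z) hY.measurable_path.aemeasurable
  rw [← integral_map hr.aemeasurable hg.aestronglyMeasurable,
    ← integral_map hY.measurable_path.aemeasurable hF.aestronglyMeasurable, ← integral_prod_mul,
    ← hY.map_optionalTime_eq_prod hτ x z,
    integral_map (hr.prodMk (hY.measurable_shift_path hr)).aemeasurable]
  exact ((hg.comp measurable_fst).mul (hF.comp measurable_snd)).aestronglyMeasurable

end OptionalTime

end IsCTMC

/-! ### Passage transforms as sub-probability weights -/

namespace IsCTMC

variable {Ω : Type*} [MeasurableSpace Ω] {S : Finset ℝ} {G : Matrix S S ℝ} {P : S → Measure Ω}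
  {Y : ℝ≥0 → Ω → S}

theorem isStepPath (hY : IsCTMC G P Y) (ω : Ω) : IsStepPath fun t => (Y t ω : ℝ) :=
  (hY.path ω).isStepPath

theorem measurableSet_firstPassage_lt (hY : IsCTMC G P Y) (A : Set ℝ) (c : ℝ≥0) :
    MeasurableSet[⨆ u ∈ Iic c, MeasurableSpace.comap (Y u) inferInstance]
      {ω | firstPassage A (fun t => (Y t ω : ℝ)) < c} := by
  simp only [firstPassage_lt_iff (hY.isStepPath _), ofPred_exists]
  refine MeasurableSet.iUnion fun i => MeasurableSet.inter (MeasurableSet.const _) ?_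
  by_cases hi : TopologicalSpace.denseSeq ℝ≥0 i < c
  · refine MeasurableSet.inter (MeasurableSet.const _) ?_
    exact (le_biSup (fun u => MeasurableSpace.comap (Y u) inferInstance) (mem_Iic.2 hi.le)) _
      ⟨{z : S | (z : ℝ) ∉ A}, Set.Finite.measurableSet (Set.toFinite _), rfl⟩
  · simp only [ENNReal.coe_lt_coe, hi, false_and]
    exact MeasurableSet.const False

theorem measurable_firstPassage (hY : IsCTMC G P Y) (A : Set ℝ) :
    Measurable fun ω => firstPassage A (fun t => (Y t ω : ℝ)) :=
  hY.measurable_of_optionalTime (hY.measurableSet_firstPassage_lt A)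

/-- The paths that leave `A` at the state `z`. -/
def exitEvent (Y : ℝ≥0 → Ω → S) (A : Set ℝ) (z : S) : Set Ω :=
  {ω | firstPassage A (fun t => (Y t ω : ℝ)) ≠ ∞ ∧
    Y (firstPassage A (fun t => (Y t ω : ℝ))).toNNReal ω = z}

theorem measurableSet_exitEvent (hY : IsCTMC G P Y) (A : Set ℝ) (z : S) :
    MeasurableSet (exitEvent Y A z) := by
  have h := hY.measurable_shift_path (hY.measurable_firstPassage A).ennreal_toNNReal
  refine ((hY.measurable_firstPassage A) (measurableSet_singleton ∞)).compl.inter ?_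
  have h0 := (StepPath.measurable_apply 0).comp h
  simp only [Function.comp_def, StepPath.shift_apply, add_zero] at h0
  exact h0 (measurableSet_singleton z)

theorem exitEvent_eq_empty (hY : IsCTMC G P Y) {A : Set ℝ} {z : S} (hz : (z : ℝ) ∈ A) :
    exitEvent Y A z = ∅ := by
  refine eq_empty_of_forall_notMem ?_
  rintro ω ⟨h, rfl⟩
  exact notMem_of_firstPassage_eq (hY.isStepPath ω) (ENNReal.coe_toNNReal h).symm hz

omit [MeasurableSpace Ω] in
theorem pairwise_disjoint_exitEvent (A : Set ℝ) :
    Pairwise (Function.onFun Disjoint (exitEvent Y A)) := fun _ _ h =>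
  disjoint_left.2 fun _ h1 h2 => h (h1.2.symm.trans h2.2)

theorem passageTransform_pointIndicator (hY : IsCTMC G P Y) (A : Set ℝ) (q : ℂ) (x z : S) :
    passageTransform P Y A (fun _ => q) x (pointIndicator z) =
      ∫ ω in exitEvent Y A z, discount q (firstPassage A (fun t => (Y t ω : ℝ))).toNNReal ∂(P x) := by
  rw [← integral_indicator (hY.measurableSet_exitEvent A z)]
  refine integral_congr_ae (Eventually.of_forall fun ω => ?_)
  dsimp only
  by_cases h : firstPassage A (fun t => (Y t ω : ℝ)) = ∞
  · rw [if_pos h, indicator_of_notMem fun hm => hm.1 h]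
  · rw [if_neg h]
    by_cases hz : Y (firstPassage A (fun t => (Y t ω : ℝ))).toNNReal ω = z
    · rw [indicator_of_mem (show ω ∈ exitEvent Y A z from ⟨h, hz⟩), pointIndicator, if_pos hz,
        discount, if_neg ENNReal.coe_ne_top, ENNReal.coe_toNNReal h]
      simp [mul_comm]
    · rw [indicator_of_notMem fun hm => hz hm.2, pointIndicator, if_neg hz, mul_zero]

theorem passageTransform_eq_zero (hY : IsCTMC G P Y) {A : Set ℝ} (q : ℂ) (x : S) {z : S}
    (hz : (z : ℝ) ∈ A) : passageTransform P Y A (fun _ => q) x (pointIndicator z) = 0 := by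
  rw [hY.passageTransform_pointIndicator, hY.exitEvent_eq_empty hz, Measure.restrict_empty,
    integral_zero_measure]

theorem integrable_discount (hY : IsCTMC G P Y) {q : ℂ} (hq : 0 < q.re) (x : S) {T : Ω → ℝ≥0∞}
    (hT : Measurable T) : Integrable (fun ω => discount q (T ω)) (P x) := by
  have := hY.prob x
  exact Integrable.of_bound ((measurable_discount q).comp hT).aestronglyMeasurable 1
    (Eventually.of_forall fun ω => norm_discount_le_one hq _)

/-- The exit events for different states are disjoint. -/
theorem sum_norm_passageTransform_le (hY : IsCTMC G P Y) {q : ℂ} (hq : 0 < q.re) (A : Set ℝ)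
    (x : S) : ∑ z, ‖passageTransform P Y A (fun _ => q) x (pointIndicator z)‖ ≤
      ∫ ω, ‖discount q (firstPassage A (fun t => (Y t ω : ℝ)))‖ ∂(P x) := by
  have hi := (hY.integrable_discount hq x (hY.measurable_firstPassage A)).norm
  calc
    _ ≤ ∑ z, ∫ ω in exitEvent Y A z, ‖discount q (firstPassage A (fun t => (Y t ω : ℝ)))‖ ∂(P x) := by
      refine Finset.sum_le_sum fun z _ => ?_
      rw [hY.passageTransform_pointIndicator]
      refine (norm_integral_le_integral_norm _).trans_eq ?_
      refine setIntegral_congr_fun (hY.measurableSet_exitEvent A z) fun ω hω => ?_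
      rw [ENNReal.coe_toNNReal hω.1]
    _ = ∫ ω in ⋃ z, exitEvent Y A z, ‖discount q (firstPassage A (fun t => (Y t ω : ℝ)))‖ ∂(P x) :=
      (integral_iUnion_fintype (hY.measurableSet_exitEvent A) (pairwise_disjoint_exitEvent A)
        fun z => hi.integrableOn).symm
    _ ≤ _ := setIntegral_le_integral hi (Eventually.of_forall fun _ => norm_nonneg _)

theorem sum_norm_passageTransform_le_one (hY : IsCTMC G P Y) {q : ℂ} (hq : 0 < q.re) (A : Set ℝ)
    (x : S) : ∑ z, ‖passageTransform P Y A (fun _ => q) x (pointIndicator z)‖ ≤ 1 := by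
  have := hY.prob x
  refine (hY.sum_norm_passageTransform_le hq A x).trans ?_
  refine (integral_mono (hY.integrable_discount hq x (hY.measurable_firstPassage A)).norm
    (integrable_const 1) fun ω => norm_discount_le_one hq _).trans_eq ?_
  simp

/-- Started inside `A`, the chain needs a positive time to leave, so the discount factor has modulus
below `1` almost surely. -/
theorem sum_norm_passageTransform_lt_one (hY : IsCTMC G P Y) {q : ℂ} (hq : 0 < q.re) {A : Set ℝ}
    {x : S} (hx : (x : ℝ) ∈ A) :
    ∑ z, ‖passageTransform P Y A (fun _ => q) x (pointIndicator z)‖ < 1 := by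
  have := hY.prob x
  refine (hY.sum_norm_passageTransform_le hq A x).trans_lt ?_
  have hi := (hY.integrable_discount hq x (hY.measurable_firstPassage A)).norm
  have hlt : ∀ᵐ ω ∂(P x), ‖discount q (firstPassage A (fun t => (Y t ω : ℝ)))‖ < 1 := by
    filter_upwards [hY.start x] with ω hω
    exact norm_discount_lt_one hq (firstPassage_pos (hY.isStepPath ω) (by rwa [hω]))
  have hsupp : Function.support (fun ω =>
      1 - ‖discount q (firstPassage A (fun t => (Y t ω : ℝ)))‖) =ᵐ[P x] univ :=
    eventuallyEq_univ.2 (hlt.mono fun ω h => (sub_pos.2 h).ne')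
  have h1 : 0 < ∫ ω, (1 - ‖discount q (firstPassage A (fun t => (Y t ω : ℝ)))‖) ∂(P x) := by
    rw [integral_pos_iff_support_of_nonneg_ae (hlt.mono fun ω h => sub_nonneg.2 h.le)
      ((integrable_const 1).sub hi), measure_congr hsupp, measure_univ]
    exact zero_lt_one
  rw [integral_sub (integrable_const 1) hi, integral_const, probReal_univ, one_smul] at h1
  exact sub_pos.1 h1

/-! ### Renewal recursion and geometric decay -/

theorem integrable_drawdownDiscount (hY : IsCTMC G P Y) {q : ℂ} (hq : 0 < q.re) {a : ℝ} (ha : 0 < a)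
    (x y : S) (n : ℕ) : Integrable (drawdownDiscount Y a q y n) (P x) :=
  hY.integrable_discount hq x ((measurable_drawdownTime ha (y : ℝ) n).comp hY.measurable_path)

theorem norm_integral_drawdownDiscount_le_one (hY : IsCTMC G P Y) {q : ℂ} (hq : 0 < q.re) (a : ℝ)
    (x y : S) (n : ℕ) : ‖∫ ω, drawdownDiscount Y a q y n ω ∂(P x)‖ ≤ 1 := by
  have := hY.prob x
  have h := norm_integral_le_of_norm_le_const (μ := P x) (f := drawdownDiscount Y a q y n)
    (Eventually.of_forall fun ω => norm_discount_le_one hq _)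
  rwa [probReal_univ, mul_one] at h

theorem integral_drawdownDiscount_zero (hY : IsCTMC G P Y) (q : ℂ) (a : ℝ) (x y : S) :
    ∫ ω, drawdownDiscount Y a q y 0 ω ∂(P x) = 1 := by
  have := hY.prob x
  simp [drawdownDiscount, drawdownTime, discount]

/-- Decomposition of an expected discount factor at the first passage out of `A`. -/
theorem integral_drawdownDiscount_eq_sum (hY : IsCTMC G P Y) {q : ℂ} (hq : 0 < q.re) {a : ℝ}
    (ha : 0 < a) (A : Set ℝ) (x y : S) (n : ℕ) (m : S → S) (k : S → ℕ)
    (htop : ∀ᵐ ω ∂(P x), firstPassage A (fun t => (Y t ω : ℝ)) = ∞ →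
      drawdownTime a y (fun t => (Y t ω : ℝ)) n = ∞)
    (hshift : ∀ᵐ ω ∂(P x), ∀ T : ℝ≥0, firstPassage A (fun t => (Y t ω : ℝ)) = T →
      drawdownTime a y (fun t => (Y t ω : ℝ)) n =
        T + drawdownTime a (m (Y T ω)) (fun t => (Y (T + t) ω : ℝ)) (k (Y T ω))) :
    ∫ ω, drawdownDiscount Y a q y n ω ∂(P x) =
      ∑ z, passageTransform P Y A (fun _ => q) x (pointIndicator z) *
        ∫ ω, drawdownDiscount Y a q (m z) (k z) ω ∂(P z) := by
  have hD := hY.integrable_drawdownDiscount hq ha x y n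
  -- Paths that never leave `A` have discount factor `0`.
  have h1 : ∫ ω, drawdownDiscount Y a q y n ω ∂(P x) =
      ∫ ω in ⋃ z, exitEvent Y A z, drawdownDiscount Y a q y n ω ∂(P x) := by
    rw [← integral_indicator (MeasurableSet.iUnion (hY.measurableSet_exitEvent A))]
    refine integral_congr_ae ?_
    filter_upwards [htop] with ω hω
    by_cases h : firstPassage A (fun t => (Y t ω : ℝ)) = ∞
    · rw [indicator_of_notMem, drawdownDiscount, hω h, discount, if_pos rfl]
      exact fun hm => (mem_iUnion.1 hm).elim fun z hz => hz.1 h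
    · have hmem : ω ∈ exitEvent Y A (Y (firstPassage A (fun t => (Y t ω : ℝ))).toNNReal ω) :=
        ⟨h, rfl⟩
      rw [indicator_of_mem (mem_iUnion.2 ⟨_, hmem⟩)]
  rw [h1, integral_iUnion_fintype (hY.measurableSet_exitEvent A) (pairwise_disjoint_exitEvent A)
    fun z => hD.integrableOn]
  refine Finset.sum_congr rfl fun z _ => ?_
  rw [hY.passageTransform_pointIndicator]
  refine Eq.trans ?_ (hY.setIntegral_optionalTime (hY.measurableSet_firstPassage_lt A) x z
    (g := fun t => discount q t) ((measurable_discount q).comp measurable_coe_nnreal_ennreal)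
    ((measurable_discount q).comp (measurable_drawdownTime ha (m z : ℝ) (k z))))
  refine setIntegral_congr_ae (hY.measurableSet_exitEvent A z) ?_
  filter_upwards [hshift] with ω hω hz
  rw [drawdownDiscount, hω _ (ENNReal.coe_toNNReal hz.1).symm, discount_add, hz.2]
  rfl

theorem integral_drawdownDiscount_of_Iio (hY : IsCTMC G P Y) {q : ℂ} (hq : 0 < q.re) {a : ℝ}
    (ha : 0 < a) (x y : S) (n : ℕ) :
    ∫ ω, drawdownDiscount Y a q y (n + 1) ω ∂(P x) =
      ∑ z ∈ Finset.univ.filter (fun z : S => (y : ℝ) ≤ z),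
        passageTransform P Y (Iio (y : ℝ)) (fun _ => q) x (pointIndicator z) *
          ∫ ω, drawdownDiscount Y a q z (n + 1) ω ∂(P z) := by
  rw [hY.integral_drawdownDiscount_eq_sum hq ha (Iio (y : ℝ)) x y (n + 1) (fun z => z)
    fun _ => n + 1]
  · refine (Finset.sum_filter_of_ne fun z _ hz => not_lt.1 fun h => hz ?_).symm
    rw [hY.passageTransform_eq_zero q x (mem_Iio.2 h), zero_mul]
  · exact Eventually.of_forall fun ω h =>
      drawdownTime_eq_top_of_firstPassage_Iio ha (hY.isStepPath ω) h n
  · exact Eventually.of_forall fun ω T h =>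
      drawdownTime_of_firstPassage_Iio ha (hY.isStepPath ω) h n

theorem integral_drawdownDiscount_of_Ioc (hY : IsCTMC G P Y) {q : ℂ} (hq : 0 < q.re) {a : ℝ}
    (ha : 0 < a) (y : S) (n : ℕ) :
    ∫ ω, drawdownDiscount Y a q y (n + 1) ω ∂(P y) =
      (∑ z ∈ Finset.univ.filter (fun z : S => (z : ℝ) ≤ y - a),
        passageTransform P Y (Ioc (y - a : ℝ) y) (fun _ => q) y (pointIndicator z) *
          ∫ ω, drawdownDiscount Y a q y n ω ∂(P z)) +
      ∑ z ∈ Finset.univ.filter (fun z : S => (y : ℝ) < z),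
        passageTransform P Y (Ioc (y - a : ℝ) y) (fun _ => q) y (pointIndicator z) *
          ∫ ω, drawdownDiscount Y a q z (n + 1) ω ∂(P z) := by
  -- The exit state decides the restart: below, the maximum `y` is kept and one index is used up;
  -- above, the maximum becomes `z`.
  rw [hY.integral_drawdownDiscount_eq_sum hq ha (Ioc (y - a : ℝ) y) y y (n + 1)
    (fun z => if (z : ℝ) ≤ y - a then y else z) fun z => if (z : ℝ) ≤ y - a then n else n + 1]
  · rw [Finset.sum_filter, Finset.sum_filter, ← Finset.sum_add_distrib]
    refine Finset.sum_congr rfl fun z _ => ?_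
    by_cases h1 : (z : ℝ) ≤ y - a
    · have h2 : ¬ (y : ℝ) < z := by linarith
      simp only [if_pos h1, if_neg h2, add_zero]
    · by_cases h2 : (y : ℝ) < z
      · simp only [if_neg h1, if_pos h2, zero_add]
      · simp only [if_neg h1, if_neg h2, add_zero,
          hY.passageTransform_eq_zero q y (mem_Ioc.2 ⟨not_le.1 h1, not_lt.1 h2⟩), zero_mul]
  · exact Eventually.of_forall fun ω h =>
      drawdownTime_eq_top_of_firstPassage_Ioc ha (hY.isStepPath ω) h n
  · filter_upwards [hY.start y] with ω hω T h
    have hw := hY.isStepPath ω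
    by_cases h1 : (Y T ω : ℝ) ≤ y - a
    · simp only [if_pos h1]
      exact drawdownTime_of_firstPassage_Ioc_of_le ha hw (congrArg _ hω) h h1 n
    · simp only [if_neg h1]
      refine drawdownTime_of_firstPassage_Ioc_of_gt ha hw h ?_ n
      exact not_le.1 fun h2 => notMem_of_firstPassage_eq hw h ⟨not_le.1 h1, h2⟩

/-- The recursion out of `Iio y` reduces bounds to starts at the running maximum. -/
theorem norm_integral_drawdownDiscount_le (hY : IsCTMC G P Y) {q : ℂ} (hq : 0 < q.re) {a : ℝ}
    (ha : 0 < a) {n : ℕ} {C : ℝ} (hC : 0 ≤ C)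
    (h : ∀ z : S, ‖∫ ω, drawdownDiscount Y a q z (n + 1) ω ∂(P z)‖ ≤ C) (x y : S) :
    ‖∫ ω, drawdownDiscount Y a q y (n + 1) ω ∂(P x)‖ ≤ C := by
  rw [hY.integral_drawdownDiscount_of_Iio hq ha]
  calc
    _ ≤ ∑ z ∈ Finset.univ.filter (fun z : S => (y : ℝ) ≤ z),
        ‖passageTransform P Y (Iio (y : ℝ)) (fun _ => q) x (pointIndicator z)‖ * C := by
      refine norm_sum_le_of_le _ fun z _ => ?_
      rw [norm_mul]
      exact mul_le_mul_of_nonneg_left (h z) (norm_nonneg _)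
    _ ≤ ∑ z, ‖passageTransform P Y (Iio (y : ℝ)) (fun _ => q) x (pointIndicator z)‖ * C :=
      Finset.sum_le_univ_sum_of_nonneg fun z => mul_nonneg (norm_nonneg _) hC
    _ ≤ 1 * C := by
      rw [← Finset.sum_mul]
      exact mul_le_mul_of_nonneg_right (hY.sum_norm_passageTransform_le_one hq _ x) hC
    _ = C := one_mul C

theorem exists_norm_integral_drawdownDiscount_le_pow (hY : IsCTMC G P Y) {q : ℂ} (hq : 0 < q.re)
    {a : ℝ} (ha : 0 < a) : ∃ ρ : ℝ, 0 ≤ ρ ∧ ρ < 1 ∧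
      ∀ (n : ℕ) (x y : S), ‖∫ ω, drawdownDiscount Y a q y (n + 1) ω ∂(P x)‖ ≤ ρ ^ n := by
  rcases isEmpty_or_nonempty S with hS | hS
  · exact ⟨0, le_rfl, zero_lt_one, fun n x => (hS.false x).elim⟩
  obtain ⟨y₀, hy₀⟩ := Finite.exists_max fun y : S =>
    ∑ z, ‖passageTransform P Y (Ioc (y - a : ℝ) y) (fun _ => q) y (pointIndicator z)‖
  set ρ := ∑ z, ‖passageTransform P Y (Ioc (y₀ - a : ℝ) y₀) (fun _ => q) y₀ (pointIndicator z)‖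
  have hρ0 : 0 ≤ ρ := Finset.sum_nonneg fun _ _ => norm_nonneg _
  have hρ1 : ρ < 1 := hY.sum_norm_passageTransform_lt_one hq ⟨by linarith, le_rfl⟩
  refine ⟨ρ, hρ0, hρ1, fun n => ?_⟩
  induction n with
  | zero =>
    intro x y
    rw [pow_zero]
    exact hY.norm_integral_drawdownDiscount_le_one hq a x y 1
  | succ n ih =>
    refine hY.norm_integral_drawdownDiscount_le hq ha (by positivity) ?_
    obtain ⟨y, hy⟩ := Finite.exists_max fun z : S =>
      ‖∫ ω, drawdownDiscount Y a q z (n + 1 + 1) ω ∂(P z)‖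
    refine fun z => (hy z).trans ?_
    set M := ‖∫ ω, drawdownDiscount Y a q y (n + 1 + 1) ω ∂(P y)‖ with hM
    -- Upward exits do not lower the index, so the largest diagonal value `M` appears on both sides
    -- of its own estimate.
    have key : ∀ B, ρ ^ n ≤ B → M ≤ B → M ≤ ρ * B := by
      intro B hB hMB
      have hC : 0 ≤ B := le_trans (by positivity) hB
      rw [hM, hY.integral_drawdownDiscount_of_Ioc hq ha, Finset.sum_filter, Finset.sum_filter,
        ← Finset.sum_add_distrib]
      refine le_trans (norm_sum_le_of_le _ fun z _ => ?_) (((Finset.sum_mul _ _ _).symm.trans_le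
        (mul_le_mul_of_nonneg_right (hy₀ y) hC)))
      by_cases h1 : (z : ℝ) ≤ y - a
      · have h2 : ¬ (y : ℝ) < z := by linarith
        rw [if_pos h1, if_neg h2, add_zero, norm_mul]
        exact mul_le_mul_of_nonneg_left ((ih z y).trans hB) (norm_nonneg _)
      · rw [if_neg h1, zero_add]
        split_ifs with h2
        · rw [norm_mul]
          exact mul_le_mul_of_nonneg_left ((hy z).trans hMB) (norm_nonneg _)
        · rw [norm_zero]
          exact mul_nonneg (norm_nonneg _) hC
    rw [pow_succ']
    rcases le_total M (ρ ^ n) with h | h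
    · exact key _ le_rfl h
    -- If `M` dominates `ρ ^ n`, then `M ≤ ρ * M` with `ρ < 1`.
    · have : M ≤ 0 := by nlinarith [key M h le_rfl]
      exact this.trans (by positivity)

theorem summable_integral_drawdownDiscount (hY : IsCTMC G P Y) {q : ℂ} (hq : 0 < q.re)
    {a : ℝ} (ha : 0 < a) (x y : S) :
    Summable fun n : ℕ => ∫ ω, drawdownDiscount Y a q y (n + 1) ω ∂(P x) := by
  obtain ⟨ρ, h0, h1, h⟩ := hY.exists_norm_integral_drawdownDiscount_le_pow hq ha
  exact Summable.of_norm_bounded (summable_geometric_of_lt_one h0 h1) fun n => h n x y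

theorem hasSum_drawdownSum (hY : IsCTMC G P Y) {q : ℂ} (hq : 0 < q.re) {a : ℝ} (ha : 0 < a)
    (x y : S) :
    HasSum (fun n : ℕ => ∫ ω, drawdownDiscount Y a q y (n + 1) ω ∂(P x))
      (drawdownSum P Y a q x y) :=
  (hY.summable_integral_drawdownDiscount hq ha x y).hasSum

/-- The zeroth term is `1` because the zeroth drawdown time is `0`; this is the source of `1 + J`
after a downward exit. -/
theorem hasSum_one_add_drawdownSum (hY : IsCTMC G P Y) {q : ℂ} (hq : 0 < q.re) {a : ℝ}
    (ha : 0 < a) (x y : S) :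
    HasSum (fun n : ℕ => ∫ ω, drawdownDiscount Y a q y n ω ∂(P x))
      (1 + drawdownSum P Y a q x y) := by
  have h := (hasSum_nat_add_iff (f := fun n : ℕ => ∫ ω, drawdownDiscount Y a q y n ω ∂(P x)) 1).1
    (hY.hasSum_drawdownSum hq ha x y)
  rwa [Finset.sum_range_one, hY.integral_drawdownDiscount_zero, add_comm] at h

end IsCTMC

theorem mainTheorem8 {Ω : Type*} [MeasurableSpace Ω] (S : Finset ℝ) (G : Matrix S S ℝ)
    (hG : IsRateMatrix G) (P : S → Measure Ω) (Y : ℝ≥0 → Ω → S) (hY : IsCTMC G P Y)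
    (a : ℝ) (ha : 0 < a) (q : ℂ) (hq : 0 < q.re) :
    (∀ x y : S, (∀ n : ℕ, Integrable (drawdownDiscount Y a q y (n + 1)) (P x)) ∧
      Summable (fun n : ℕ => ∫ ω, drawdownDiscount Y a q y (n + 1) ω ∂(P x))) ∧
    (∀ x y : S, drawdownSum P Y a q x y =
      ∑ z ∈ Finset.univ.filter (fun z : S => (y : ℝ) ≤ z),
        passageTransform P Y (Iio (y : ℝ)) (fun _ => q) x (pointIndicator z) *
          drawdownSum P Y a q z z) ∧
    (∀ y : S, drawdownSum P Y a q y y =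
      (∑ z ∈ Finset.univ.filter (fun z : S => (z : ℝ) ≤ y - a),
        passageTransform P Y (Ioc (y - a : ℝ) y) (fun _ => q) y (pointIndicator z) *
          (1 + drawdownSum P Y a q z y)) +
      ∑ z ∈ Finset.univ.filter (fun z : S => (y : ℝ) < z),
        passageTransform P Y (Ioc (y - a : ℝ) y) (fun _ => q) y (pointIndicator z) *
          drawdownSum P Y a q z z) := by
  refine ⟨fun x y => ⟨fun n => hY.integrable_drawdownDiscount hq ha x y (n + 1),
    hY.summable_integral_drawdownDiscount hq ha x y⟩, fun x y => ?_, fun y => ?_⟩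
  · refine (hY.hasSum_drawdownSum hq ha x y).unique ?_
    simp only [hY.integral_drawdownDiscount_of_Iio hq ha x y]
    exact hasSum_sum fun z _ => (hY.hasSum_drawdownSum hq ha z z).mul_left _
  · refine (hY.hasSum_drawdownSum hq ha y y).unique ?_
    simp only [hY.integral_drawdownDiscount_of_Ioc hq ha y]
    exact (hasSum_sum fun z _ => (hY.hasSum_one_add_drawdownSum hq ha z y).mul_left _).add
      (hasSum_sum fun z _ => (hY.hasSum_drawdownSum hq ha z z).mul_left _)
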